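/- There is a strictly increasing infinite sequence $T=\{t_i\}_{i\in\mathbb N}$ of positive integers that contains no 3-term geometric progression with integer ratio (that is, there are no positive integers $a$ and $r\ge 2$ such that $a$, $ar$ and $ar^2$ are all terms of $T$), and such that for every $\varepsilon>0$ there exists a constant $C_\varepsilon>0$ satisfying $$t_{i+1}-t_i<C_\varepsilon\,t_i^{\varepsilon}\qquad\text{for all } i\in\mathbb N.$$ -/

import Mathlib

/-- `a = (a₀, …, a_{k-1})` is a geometric progression of length `k` with common ratio `r`:
its terms are nonzero real numbers and `aᵢ = r aᵢ₋₁` for `i = 1, …, k - 1`. -/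
def IsGeometricProgression (k : ℕ) (r : ℝ) (a : Fin k → ℝ) : Prop :=
  (∀ i, a i ≠ 0) ∧ ∀ i j : Fin k, (j : ℕ) = (i : ℕ) + 1 → a j = r * a i

/-- The set `T` contains no `k`-term geometric progression whose common ratio is an
integer at least `2`. -/
def AvoidsIntegerRatioGP (k : ℕ) (T : Set ℕ) : Prop :=
  ¬ ∃ (r : ℤ) (a : Fin k → ℕ), 2 ≤ r ∧ (∀ i, a i ∈ T) ∧
    IsGeometricProgression k (r : ℝ) (fun i => (a i : ℝ))

/-! Cut the integers from some `s₀` on into consecutive blocks, the one starting at `m` having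
length a little over 8 times the largest `d(k)` with `k ≤ 4 * m ^ 2`. By the divisor bound this
length is `O(m ^ ε)` for every `ε > 0`, so any sequence with one term in each block has the required
gaps.

To avoid progressions, join two integers if they can be the last two terms `a * r`, `a * r ^ 2` of
one. Then `n` has at most `2 * d(n)` neighbours, few compared with the blocks they lie in, and
`exists_independent_transversal` selects pairwise non-adjacent terms. It rests on a counting
argument in the style of the local lemma (`card_independentChoices_le_two_mul`), extended to
infinitely many blocks by compactness. -/

/-- The divisor bound: `d(n) = O(n ^ ε)` for every `ε > 0`. -/
theorem Nat.exists_card_divisors_le_mul_rpow {ε : ℝ} (hε : 0 < ε) :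
    ∃ C : ℝ, 1 ≤ C ∧ ∀ n : ℕ, n ≠ 0 → (n.divisors.card : ℝ) ≤ C * (n : ℝ) ^ ε := by
  set K : ℝ := 1 + 1 / (ε * Real.log 2) with hK
  have hlog : 0 < Real.log 2 := Real.log_pos one_lt_two
  have hK1 : 1 ≤ K := by
    have : 0 < 1 / (ε * Real.log 2) := by positivity
    linarith
  obtain ⟨M, hM⟩ := exists_nat_ge ((2 : ℝ) ^ (1 / ε))
  have two_rpow_le {p : ℕ} (hp : M ≤ p) : (2 : ℝ) ≤ (p : ℝ) ^ ε := by
    calc (2 : ℝ) = ((2 : ℝ) ^ (1 / ε)) ^ ε := by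
          rw [← Real.rpow_mul (by norm_num), one_div_mul_cancel hε.ne', Real.rpow_one]
      _ ≤ (p : ℝ) ^ ε := by
          apply Real.rpow_le_rpow (by positivity) _ hε.le
          exact hM.trans (by exact_mod_cast hp)
  -- Primes `p ≥ M` satisfy `p ^ ε ≥ 2`, and `2 ^ a ≥ a + 1`. A smaller prime costs a factor `K`,
  -- chosen so that `K * (1 + a * x) ≥ a + 1` for `x = ε * log 2`; there are at most `M` of these.
  have prime_pow_bound (p a : ℕ) (hp : 2 ≤ p) :
      (a : ℝ) + 1 ≤ (if p < M then K else 1) * ((p : ℝ) ^ a) ^ ε := by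
    split_ifs with h
    · have h1 : (1 : ℝ) + a * (ε * Real.log 2) ≤ ((p : ℝ) ^ a) ^ ε := by
        calc (1 : ℝ) + a * (ε * Real.log 2) ≤ Real.exp (a * (ε * Real.log 2)) := by
              linarith [Real.add_one_le_exp (a * (ε * Real.log 2))]
          _ = ((2 : ℝ) ^ a) ^ ε := by
              rw [← Real.rpow_natCast, ← Real.rpow_mul (by norm_num),
                Real.rpow_def_of_pos (by norm_num)]
              ring_nf
          _ ≤ ((p : ℝ) ^ a) ^ ε := by
              have : (2 : ℝ) ≤ p := by exact_mod_cast hp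
              gcongr
      have h2 : K * (1 + a * (ε * Real.log 2)) =
          a + 1 + (a * (ε * Real.log 2) + 1 / (ε * Real.log 2)) := by
        rw [hK]; field_simp; ring
      have h3 : 0 ≤ a * (ε * Real.log 2) + 1 / (ε * Real.log 2) := by positivity
      nlinarith [mul_le_mul_of_nonneg_left h1 (zero_le_one.trans hK1)]
    · rw [one_mul, ← Real.rpow_natCast, ← Real.rpow_mul (by positivity), mul_comm,
        Real.rpow_mul (by positivity), Real.rpow_natCast]
      calc (a : ℝ) + 1 ≤ 2 ^ a := by exact_mod_cast Nat.lt_two_pow_self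
        _ ≤ _ := by gcongr; exact two_rpow_le (not_lt.1 h)
  refine ⟨K ^ M, one_le_pow₀ hK1, fun n hn => ?_⟩
  have hprod : (n : ℝ) = ∏ p ∈ n.primeFactors, (p : ℝ) ^ n.factorization p := by
    conv_lhs => rw [← Nat.prod_factorization_pow_eq_self hn]
    simp [Finsupp.prod]
  calc (n.divisors.card : ℝ) = ∏ p ∈ n.primeFactors, ((n.factorization p : ℝ) + 1) := by
        rw [Nat.card_divisors hn]; push_cast; rfl
    _ ≤ ∏ p ∈ n.primeFactors,
          (if p < M then K else 1) * ((p : ℝ) ^ n.factorization p) ^ ε :=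
        Finset.prod_le_prod (fun _ _ => by positivity) fun p hp =>
          prime_pow_bound p _ (Nat.prime_of_mem_primeFactors hp).two_le
    _ = (∏ p ∈ n.primeFactors, if p < M then K else 1) * (n : ℝ) ^ ε := by
        rw [Finset.prod_mul_distrib, Real.finsetProd_rpow _ _ (fun _ _ => by positivity), ← hprod]
    _ ≤ K ^ M * (n : ℝ) ^ ε := by
        gcongr
        rw [Finset.prod_ite, Finset.prod_const, Finset.prod_const_one, mul_one]
        apply pow_le_pow_right₀ hK1
        calc _ ≤ (Finset.range M).card := Finset.card_le_card fun p hp => by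
              simpa using (Finset.mem_filter.1 hp).2
          _ = M := Finset.card_range M

/-! ### Independent transversals by counting -/

section Transversal

open Finset

variable {ι α : Type*} [DecidableEq ι] [DecidableEq α]

/-- The choice functions of the family `V` that, on the index set `J`, pick pairwise non-neighbouring
elements, where `N a` is the set of neighbours of `a`. -/
def independentChoices [Fintype ι] (V : ι → Finset α) (N : α → Finset α) (J : Finset ι) :
    Finset (ι → α) :=
  {f ∈ Fintype.piFinset V | ∀ i ∈ J, ∀ j ∈ J, i ≠ j → f j ∉ N (f i)}

/-- In a set of choice functions that does not constrain the `i`-th coordinate, each value of that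
coordinate is taken equally often. -/
theorem card_filter_apply_eq_mul_card {V : ι → Finset α} {i : ι} {A : Finset (ι → α)}
    (hV : ∀ f ∈ A, f i ∈ V i) (hA : ∀ f ∈ A, ∀ v ∈ V i, Function.update f i v ∈ A)
    {v : α} (hv : v ∈ V i) : #{f ∈ A | f i = v} * #(V i) = #A := by
  have key : ∀ w ∈ V i, #{f ∈ A | f i = w} = #{f ∈ A | f i = v} := fun w hw => by
    refine card_bij' (fun f _ => Function.update f i v) (fun f _ => Function.update f i w)
      ?_ ?_ ?_ ?_ <;> simp +contextual [hA, hv, hw]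
  rw [card_eq_sum_card_fiberwise (f := fun f => f i) (t := V i) (fun f hf => hV f hf), sum_congr rfl key, sum_const,
    smul_eq_mul, mul_comm]

variable [Fintype ι] {V : ι → Finset α} {N : α → Finset α}

theorem update_mem_independentChoices {J : Finset ι} {i : ι} (hi : i ∉ J) {f : ι → α}
    (hf : f ∈ independentChoices V N J) {v : α} (hv : v ∈ V i) :
    Function.update f i v ∈ independentChoices V N J := by
  simp only [independentChoices, mem_filter, Fintype.mem_piFinset] at hf ⊢
  refine ⟨fun j => ?_, fun j hj k hk hjk => ?_⟩
  · rcases eq_or_ne j i with rfl | h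
    · simpa using hv
    · simpa [h] using hf.1 j
  · have h1 : j ≠ i := fun h => hi (h ▸ hj)
    have h2 : k ≠ i := fun h => hi (h ▸ hk)
    simpa [h1, h2] using hf.2 j hj k hk hjk

theorem card_filter_two_apply_eq {J : Finset ι} {i j : ι} (hij : i ≠ j) (hi : i ∉ J) (hj : j ∉ J)
    {v w : α} (hv : v ∈ V i) (hw : w ∈ V j) :
    #{f ∈ independentChoices V N J | f i = v ∧ f j = w} * (#(V i) * #(V j)) =
      #(independentChoices V N J) := by
  have mem : ∀ k, ∀ f ∈ independentChoices V N J, f k ∈ V k := fun k f hf =>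
    Fintype.mem_piFinset.1 (mem_filter.1 hf).1 k
  rw [← card_filter_apply_eq_mul_card (A := independentChoices V N J) (mem i)
    (fun f hf v hv => update_mem_independentChoices hi hf hv) hv,
    ← card_filter_apply_eq_mul_card (V := V) (i := j)
      (A := {f ∈ independentChoices V N J | f i = v}) _ _ hw, filter_filter]
  · ring
  · exact fun f hf => mem j f (mem_filter.1 hf).1
  · intro f hf v hv
    rw [mem_filter] at hf ⊢
    exact ⟨update_mem_independentChoices hj hf.1 hv, by simpa [hij] using hf.2⟩

/-- Adding an index to `J` keeps at least half of the independent choices. -/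
theorem card_independentChoices_le_two_mul (hne : ∀ i, (V i).Nonempty)
    (hN : ∀ v w, w ∈ N v ↔ v ∈ N w)
    (hV : ∀ i, ∀ v ∈ V i, ∑ j, (#(V j ∩ N v) : ℝ) / #(V j) ≤ 1 / 4) (J : Finset ι) :
    ∀ i ∉ J, (#(independentChoices V N J) : ℝ) ≤ 2 * #(independentChoices V N (insert i J)) := by
  induction J using Finset.strongInduction with
  | H J ih =>
  intro i hi
  set P := (#(independentChoices V N J) : ℝ) with hP
  have hpos : ∀ k, (0 : ℝ) < #(V k) := fun k => by exact_mod_cast (hne k).card_pos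
  -- A choice lost on adding `i` has some `j ∈ J` with `f i`, `f j` adjacent. Weakening `J` to
  -- `J.erase j` leaves both coordinates unconstrained, so they can be counted exactly.
  have hcover : independentChoices V N J ⊆ independentChoices V N (insert i J) ∪
      (V i).biUnion fun v => J.biUnion fun j => (V j ∩ N v).biUnion fun w =>
        {f ∈ independentChoices V N (J.erase j) | f i = v ∧ f j = w} := by
    intro f hf
    by_cases hbad : ∃ j ∈ J, f j ∈ N (f i)
    · obtain ⟨j, hj, hjN⟩ := hbad
      simp only [independentChoices, mem_filter, Fintype.mem_piFinset] at hf
      refine mem_union_right _ ?_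
      simp only [mem_biUnion, mem_filter, independentChoices, Fintype.mem_piFinset]
      exact ⟨f i, hf.1 i, j, hj, f j, mem_inter.2 ⟨hf.1 j, hjN⟩, ⟨hf.1, fun k hk l hl =>
        hf.2 k (mem_of_mem_erase hk) l (mem_of_mem_erase hl)⟩, rfl, rfl⟩
    · push Not at hbad
      refine mem_union_left _ ?_
      simp only [independentChoices, mem_filter, Fintype.mem_piFinset] at hf ⊢
      refine ⟨hf.1, fun k hk l hl hkl => ?_⟩
      rcases mem_insert.1 hk with rfl | hk <;> rcases mem_insert.1 hl with rfl | hl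
      · exact absurd rfl hkl
      · exact hbad l hl
      · rw [hN]; exact hbad k (by assumption)
      · exact hf.2 k hk l hl hkl
  have hterm : ∀ v ∈ V i, ∀ j ∈ J, ∀ w ∈ V j ∩ N v,
      (#{f ∈ independentChoices V N (J.erase j) | f i = v ∧ f j = w} : ℝ) ≤
        2 * P / (#(V i) * #(V j)) := by
    intro v hv j hj w hw
    have hij : i ≠ j := fun h => hi (h ▸ hj)
    rw [le_div_iff₀ (mul_pos (hpos i) (hpos j))]
    have h1 := card_filter_two_apply_eq (V := V) (N := N) (J := J.erase j) hij
      (fun h => hi (mem_of_mem_erase h)) (notMem_erase j J) hv (mem_inter.1 hw).1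
    -- By induction, dropping `j` at most doubles the count: this is the 2 in `2 * P`.
    have h2 := ih (J.erase j) (erase_ssubset hj) j (notMem_erase j J)
    rw [insert_erase hj] at h2
    refine le_trans (le_of_eq ?_) h2
    exact_mod_cast h1
  have hcount : P ≤ #(independentChoices V N (insert i J)) +
      ∑ v ∈ V i, ∑ j ∈ J, ∑ w ∈ V j ∩ N v,
        (#{f ∈ independentChoices V N (J.erase j) | f i = v ∧ f j = w} : ℝ) := by
    rw [hP]
    norm_cast
    refine (card_le_card hcover).trans ((card_union_le _ _).trans ?_)
    gcongr
    refine card_biUnion_le.trans (sum_le_sum fun v _ => ?_)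
    exact card_biUnion_le.trans (sum_le_sum fun j _ => card_biUnion_le)
  have hsum : ∑ v ∈ V i, ∑ j ∈ J, ∑ w ∈ V j ∩ N v,
      (#{f ∈ independentChoices V N (J.erase j) | f i = v ∧ f j = w} : ℝ) ≤ P / 2 := by
    calc _ ≤ ∑ v ∈ V i, ∑ j ∈ J, ∑ w ∈ V j ∩ N v, 2 * P / (#(V i) * #(V j)) :=
          sum_le_sum fun v hv => sum_le_sum fun j hj => sum_le_sum fun w hw => hterm v hv j hj w hw
      _ = ∑ v ∈ V i, 2 * P / #(V i) * ∑ j ∈ J, (#(V j ∩ N v) : ℝ) / #(V j) := by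
          refine sum_congr rfl fun v _ => ?_
          rw [mul_sum]
          refine sum_congr rfl fun j _ => ?_
          have := hpos i
          have := hpos j
          rw [sum_const, nsmul_eq_mul]
          field_simp
      _ ≤ ∑ v ∈ V i, 2 * P / #(V i) * (1 / 4) := by
          refine sum_le_sum fun v hv => ?_
          gcongr
          refine le_trans ?_ (hV i v hv)
          exact sum_le_sum_of_subset_of_nonneg (subset_univ _) fun _ _ _ => by positivity
      _ = P / 2 := by
          have := hpos i
          rw [sum_const, nsmul_eq_mul]
          field_simp
          ring
  linarith

theorem independentChoices_nonempty (hne : ∀ i, (V i).Nonempty)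
    (hN : ∀ v w, w ∈ N v ↔ v ∈ N w)
    (hV : ∀ i, ∀ v ∈ V i, ∑ j, (#(V j ∩ N v) : ℝ) / #(V j) ≤ 1 / 4) (J : Finset ι) :
    (independentChoices V N J).Nonempty := by
  induction J using Finset.induction_on with
  | empty => simpa [independentChoices] using hne
  | insert i J hi ih =>
    have h1 := card_independentChoices_le_two_mul hne hN hV J i hi
    have h2 : (0 : ℝ) < #(independentChoices V N J) := by exact_mod_cast ih.card_pos
    rw [← card_pos]
    exact_mod_cast (by linarith : (0 : ℝ) < #(independentChoices V N (insert i J)))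

end Transversal

open Finset in
/-- A family of nonempty finite sets `V i`, indexed by an arbitrary type, has an independent
transversal if the neighbours of each vertex have total weight at most `1 / 4`, where a vertex of
`V j` has weight `1 / #(V j)`. -/
theorem exists_independent_transversal {ι α : Type*} [DecidableEq α]
    {V : ι → Finset α} {N : α → Finset α} (hne : ∀ i, (V i).Nonempty)
    (hN : ∀ v w, w ∈ N v ↔ v ∈ N w)
    (hV : ∀ i, ∀ v ∈ V i, ∀ s : Finset ι, ∑ j ∈ s, (#(V j ∩ N v) : ℝ) / #(V j) ≤ 1 / 4) :
    ∃ f : ι → α, (∀ i, f i ∈ V i) ∧ ∀ i j, i ≠ j → f j ∉ N (f i) := by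
  classical
  -- Each finite subfamily has a solution, extended arbitrarily outside `s`; Rado selection glues
  -- these together.
  have hfin : ∀ s : Finset ι, ∃ g : ∀ i, V i, ∀ i ∈ s, ∀ j ∈ s, i ≠ j →
      (g j : α) ∉ N (g i) := by
    intro s
    obtain ⟨f, hf⟩ := independentChoices_nonempty (V := fun i : s => V i) (N := N)
      (fun i => hne i) hN (fun i v hv => by
        simpa only [sum_coe_sort s fun j => (#(V j ∩ N v) : ℝ) / #(V j)] using hV i v hv s) univ
    simp only [independentChoices, mem_filter, Fintype.mem_piFinset, mem_univ, true_imp_iff] at hf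
    refine ⟨fun i => if h : i ∈ s then ⟨f ⟨i, h⟩, hf.1 ⟨i, h⟩⟩ else ⟨_, (hne i).choose_spec⟩,
      fun i hi j hj hij => ?_⟩
    simpa [hi, hj] using hf.2 ⟨i, hi⟩ ⟨j, hj⟩ (by simpa using hij)
  choose g hg using hfin
  obtain ⟨χ, hχ⟩ := Finset.rado_selection g
  refine ⟨fun i => χ i, fun i => (χ i).2, fun i j hij => ?_⟩
  obtain ⟨t, ht, h⟩ := hχ {i, j}
  simpa only [h i (by simp), h j (by simp)] using hg t i (ht (by simp)) j (ht (by simp)) hij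


/-! ### The graph of progression neighbours -/

/-- The numbers `n * r` with `r ∣ n` and `n / r` with `r ^ 2 ∣ n`, for `r ≥ 2`: those `w` for which
`n` and `w` can be the last two terms of a geometric progression `a, a * r, a * r ^ 2`. -/
def progressionNeighbors (n : ℕ) : Finset ℕ :=
  (n.divisors.erase 1).image (n * ·) ∪ {r ∈ n.divisors.erase 1 | r ∣ n / r}.image (n / ·)

theorem mem_progressionNeighbors {n w : ℕ} : w ∈ progressionNeighbors n ↔
    n ≠ 0 ∧ w ≠ 0 ∧ ∃ r, r ≠ 1 ∧ (r ∣ n ∧ w = n * r ∨ r ∣ w ∧ n = w * r) := by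
  simp only [progressionNeighbors, Finset.mem_union, Finset.mem_image, Finset.mem_filter,
    Finset.mem_erase, Nat.mem_divisors]
  constructor
  · rintro (⟨r, ⟨h1, h2, h3⟩, rfl⟩ | ⟨r, ⟨⟨h1, h2, h3⟩, h4⟩, rfl⟩)
    · exact ⟨h3, mul_ne_zero h3 (ne_zero_of_dvd_ne_zero h3 h2), r, h1, .inl ⟨h2, rfl⟩⟩
    · exact ⟨h3, (Nat.div_pos (Nat.le_of_dvd (Nat.pos_of_ne_zero h3) h2)
        (Nat.pos_of_dvd_of_pos h2 (Nat.pos_of_ne_zero h3))).ne', r, h1,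
        .inr ⟨h4, (Nat.div_mul_cancel h2).symm⟩⟩
  · rintro ⟨hn, hw, r, hr, ⟨h1, rfl⟩ | ⟨h1, rfl⟩⟩
    · exact .inl ⟨r, ⟨hr, h1, hn⟩, rfl⟩
    · have : w * r / r = w := Nat.mul_div_cancel _ (Nat.pos_of_ne_zero (right_ne_zero_of_mul hn))
      exact .inr ⟨r, ⟨⟨hr, dvd_mul_left r w, hn⟩, this.symm ▸ h1⟩, this⟩

theorem mem_progressionNeighbors_comm (n w : ℕ) :
    w ∈ progressionNeighbors n ↔ n ∈ progressionNeighbors w := by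
  rw [mem_progressionNeighbors, mem_progressionNeighbors, and_left_comm]
  simp only [or_comm]

theorem card_progressionNeighbors_le (n : ℕ) :
    (progressionNeighbors n).card ≤ 2 * n.divisors.card := by
  have h := Finset.card_le_card (Finset.erase_subset 1 n.divisors)
  refine (Finset.card_union_le _ _).trans ?_
  have h1 := Finset.card_image_le (s := n.divisors.erase 1) (f := (n * ·))
  have h2 := Finset.card_image_le (s := {r ∈ n.divisors.erase 1 | r ∣ n / r}) (f := (n / ·))
  have h3 := Finset.card_filter_le (n.divisors.erase 1) (fun r => r ∣ n / r)
  omega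

/-- Going down from `n = w * r` requires `r ∣ w`, hence `r ≤ w`. So even a low block containing a
neighbour of `n` is long in terms of `d(n)`. -/
theorem le_sq_of_mem_progressionNeighbors {n w : ℕ} (h : w ∈ progressionNeighbors n) :
    n ≤ w ^ 2 := by
  obtain ⟨hn, hw, r, -, ⟨h1, rfl⟩ | ⟨h1, rfl⟩⟩ := mem_progressionNeighbors.1 h
  · have : 0 < r := Nat.pos_of_dvd_of_pos h1 (Nat.pos_of_ne_zero hn)
    exact (Nat.le_mul_of_pos_right n this).trans (Nat.le_self_pow two_ne_zero _)
  · rw [sq]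
    exact Nat.mul_le_mul_left _ (Nat.le_of_dvd (Nat.pos_of_ne_zero hw) h1)

/-! ### Blocks and the choice of the sequence -/

/-- The length of the block that starts at `m`. -/
def blockLength (m : ℕ) : ℕ :=
  8 * (Finset.range (4 * m ^ 2 + 1)).sup (fun k => k.divisors.card) + 1

theorem eight_mul_card_divisors_le_blockLength {m n : ℕ} (h : n ≤ 4 * m ^ 2) :
    8 * n.divisors.card ≤ blockLength m := by
  have := Finset.le_sup (f := fun k : ℕ => k.divisors.card)
    (Finset.mem_range.2 (Nat.lt_add_one_of_le h))
  simp only [blockLength]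
  omega

theorem exists_blockLength_le_mul_rpow {ε : ℝ} (hε : 0 < ε) :
    ∃ C : ℝ, 1 ≤ C ∧ ∀ m : ℕ, m ≠ 0 → (blockLength m : ℝ) ≤ C * (m : ℝ) ^ ε := by
  obtain ⟨C, hC, h⟩ := Nat.exists_card_divisors_le_mul_rpow (half_pos hε)
  refine ⟨8 * (C * 2 ^ ε) + 1, by linarith [show 0 < C * (2 : ℝ) ^ ε by positivity], fun m hm => ?_⟩
  obtain ⟨k, hk, hsup⟩ := Finset.exists_mem_eq_sup (Finset.range (4 * m ^ 2 + 1)) (by simp)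
    (fun k : ℕ => k.divisors.card)
  have hm1 : (1 : ℝ) ≤ (m : ℝ) ^ ε :=
    Real.one_le_rpow (by exact_mod_cast Nat.one_le_iff_ne_zero.2 hm) hε.le
  have hpow : ((4 * m ^ 2 : ℕ) : ℝ) ^ (ε / 2) = 2 ^ ε * (m : ℝ) ^ ε := by
    rw [show ((4 * m ^ 2 : ℕ) : ℝ) = (2 * (m : ℝ)) ^ (2 : ℝ) by norm_num; ring,
      ← Real.rpow_mul (by positivity), mul_div_cancel₀ _ two_ne_zero,
      Real.mul_rpow (by norm_num) (by positivity)]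
  have hd : (k.divisors.card : ℝ) ≤ C * (2 ^ ε * (m : ℝ) ^ ε) := by
    rcases eq_or_ne k 0 with rfl | hk0
    · simp only [Nat.divisors_zero, Finset.card_empty, Nat.cast_zero]
      positivity
    · refine (h k hk0).trans ?_
      rw [← hpow]
      have : (k : ℝ) ≤ ((4 * m ^ 2 : ℕ) : ℝ) := by
        exact_mod_cast Nat.lt_succ_iff.1 (Finset.mem_range.1 hk)
      gcongr
  rw [blockLength, hsup]
  push_cast
  linarith

theorem exists_forall_ge_blockLength_le : ∃ s₀ : ℕ, 0 < s₀ ∧ ∀ m ≥ s₀, blockLength m ≤ m := by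
  obtain ⟨C, hC, h⟩ := exists_blockLength_le_mul_rpow one_half_pos
  obtain ⟨s₀, hs₀⟩ := exists_nat_ge (C ^ 2)
  have hpos : 0 < s₀ := by
    have : (0 : ℝ) < s₀ := lt_of_lt_of_le (by positivity) hs₀
    exact_mod_cast this
  refine ⟨s₀, hpos, fun m hm => ?_⟩
  have hCm : C ≤ √m := Real.le_sqrt_of_sq_le (hs₀.trans (by exact_mod_cast hm))
  have h1 := h m (by omega)
  rw [← Real.sqrt_eq_rpow] at h1
  have h2 : C * √(m : ℝ) ≤ √m * √m := by gcongr
  rw [Real.mul_self_sqrt (by positivity)] at h2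
  exact_mod_cast h1.trans h2

/-- The left endpoints of consecutive blocks, the first of which is `s₀`. -/
def blockStart (s₀ : ℕ) : ℕ → ℕ
  | 0 => s₀
  | i + 1 => blockStart s₀ i + blockLength (blockStart s₀ i)

theorem blockStart_mono (s₀ : ℕ) : Monotone (blockStart s₀) :=
  monotone_nat_of_le_succ fun _ => Nat.le_add_right _ _

/-- There is a sequence with one term in each block and no two neighbouring terms. -/
theorem exists_block_transversal {s₀ : ℕ} (hpos : 0 < s₀)
    (hs₀ : ∀ m ≥ s₀, blockLength m ≤ m) :
    ∃ t : ℕ → ℕ, (∀ i, blockStart s₀ i ≤ t i ∧ t i < blockStart s₀ (i + 1)) ∧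
      ∀ i j, i ≠ j → t j ∉ progressionNeighbors (t i) := by
  set s := blockStart s₀
  have hmono : Monotone s := blockStart_mono s₀
  have hle (i : ℕ) : s₀ ≤ s i := hmono (Nat.zero_le i)
  set V : ℕ → Finset ℕ := fun i => Finset.Ico (s i) (s (i + 1))
  have hcard (i : ℕ) : (V i).card = blockLength (s i) := by
    simp [V, s, blockStart]
  have hdisj : Pairwise fun i j => Disjoint (V i) (V j) := fun i j hij => by
    simpa [V, Function.onFun, ← Finset.disjoint_coe] using hmono.pairwise_disjoint_on_Ico_succ hij
  obtain ⟨t, ht, hind⟩ := exists_independent_transversal (V := V) (N := progressionNeighbors)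
    (fun i => Finset.card_pos.1 (by rw [hcard]; exact Nat.succ_pos _))
    mem_progressionNeighbors_comm (fun i n hn J => by
      have hn0 : n ≠ 0 := by
        have := (Finset.mem_Ico.1 hn).1
        have := hle i
        omega
      have hd : (0 : ℝ) < n.divisors.card := by
        exact_mod_cast Finset.card_pos.2 ⟨1, by simpa using hn0⟩
      calc ∑ j ∈ J, ((V j ∩ progressionNeighbors n).card : ℝ) / (V j).card
          ≤ ∑ j ∈ J, ((V j ∩ progressionNeighbors n).card : ℝ) / (8 * n.divisors.card) := by
            refine Finset.sum_le_sum fun j _ => ?_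
            rcases Finset.eq_empty_or_nonempty (V j ∩ progressionNeighbors n) with h | ⟨w, hw⟩
            · simp [h]
            · rw [Finset.mem_inter, Finset.mem_Ico] at hw
              -- The block lies below twice its start, so `n ≤ w ^ 2 ≤ 4 * s j ^ 2`, the range
              -- covered by `blockLength`.
              have hw2 : w ≤ 2 * s j := by
                have h1 := hs₀ (s j) (hle j)
                have h2 : w < s j + blockLength (s j) := hw.1.2
                omega
              have h3 : n ≤ 4 * s j ^ 2 :=
                (le_sq_of_mem_progressionNeighbors hw.2).trans
                  ((Nat.pow_le_pow_left hw2 2).trans (by rw [mul_pow]; norm_num))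
              have h4 : (8 * n.divisors.card : ℝ) ≤ (V j).card := by
                rw [hcard]
                exact_mod_cast eight_mul_card_divisors_le_blockLength h3
              gcongr
        _ = ((J.biUnion fun j => V j ∩ progressionNeighbors n).card : ℝ) /
              (8 * n.divisors.card) := by
            rw [← Finset.sum_div, Finset.card_biUnion fun i _ j _ hij =>
              (hdisj hij).mono Finset.inter_subset_left Finset.inter_subset_left]
            push_cast
            rfl
        _ ≤ (2 * n.divisors.card : ℝ) / (8 * n.divisors.card) := by
            gcongr
            exact_mod_cast (Finset.card_le_card (Finset.biUnion_subset.2 fun j _ =>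
              Finset.inter_subset_right)).trans (card_progressionNeighbors_le n)
        _ = 1 / 4 := by
            field_simp
            norm_num)
  exact ⟨t, fun i => Finset.mem_Ico.1 (ht i), hind⟩

/-! ### Progressions and gaps -/

/-- The last two terms of a progression are already neighbours; the first term serves only to give
`r ∣ a 1`. -/
theorem avoidsIntegerRatioGP_range {t : ℕ → ℕ} (hpos : ∀ i, 0 < t i)
    (h : ∀ i j, i ≠ j → t j ∉ progressionNeighbors (t i)) :
    AvoidsIntegerRatioGP 3 (Set.range t) := by
  rintro ⟨r, a, hr, ha, -, hgp⟩
  lift r to ℕ using by omega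
  have h01 : a 1 = r * a 0 := by
    have h' := hgp 0 1 rfl
    dsimp only at h'
    exact_mod_cast h'
  have h12 : a 2 = r * a 1 := by
    have h' := hgp 1 2 rfl
    dsimp only at h'
    exact_mod_cast h'
  obtain ⟨i, hi⟩ := ha 1
  obtain ⟨j, hj⟩ := ha 2
  have hi0 := hpos i
  have hj0 := hpos j
  refine h i j ?_ (mem_progressionNeighbors.2 ⟨hi0.ne', hj0.ne', r, by omega, .inl ⟨?_, ?_⟩⟩)
  · rintro rfl
    have h' : a 1 * 1 = a 1 * r := by rw [mul_one, mul_comm, ← h12, ← hj, hi]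
    have := Nat.eq_of_mul_eq_mul_left (by omega) h'
    omega
  · rw [hi, h01]
    exact dvd_mul_right _ _
  · rw [hi, hj, h12, mul_comm]

/-- Consecutive terms lie in adjacent blocks, so their gap is less than the sum of the two lengths;
the second block starts at most at `2 * t i`, whence `2 ^ ε`. -/
theorem exists_gap_lt_mul_rpow {s₀ : ℕ} (hpos : 0 < s₀) (hs₀ : ∀ m ≥ s₀, blockLength m ≤ m)
    {t : ℕ → ℕ} (ht : ∀ i, blockStart s₀ i ≤ t i ∧ t i < blockStart s₀ (i + 1))
    {ε : ℝ} (hε : 0 < ε) :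
    ∃ C : ℝ, 0 < C ∧ ∀ i : ℕ, (t (i + 1) : ℝ) - (t i : ℝ) < C * (t i : ℝ) ^ ε := by
  obtain ⟨C, hC, h⟩ := exists_blockLength_le_mul_rpow hε
  refine ⟨C * (1 + 2 ^ ε), by positivity, fun i => ?_⟩
  set m := blockStart s₀ i
  have hm : s₀ ≤ m := blockStart_mono s₀ (Nat.zero_le i)
  have hsucc : blockStart s₀ (i + 1) = m + blockLength m := rfl
  have hlen : blockLength m ≤ m := hs₀ m hm
  have hlt : t (i + 1) < t i + blockLength m + blockLength (m + blockLength m) := by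
    have h1 : t (i + 1) < m + blockLength m + blockLength (m + blockLength m) := (ht (i + 1)).2
    have h2 := (ht i).1
    omega
  have hmt : (m : ℝ) ≤ t i := by exact_mod_cast (ht i).1
  have h1 : (blockLength m : ℝ) ≤ C * (t i : ℝ) ^ ε :=
    (h m (by omega)).trans (by gcongr)
  have h2 : (blockLength (m + blockLength m) : ℝ) ≤ C * (2 ^ ε * (t i : ℝ) ^ ε) := by
    refine (h _ (by omega)).trans ?_
    rw [← Real.mul_rpow (by norm_num) (by positivity)]
    have : ((m + blockLength m : ℕ) : ℝ) ≤ 2 * t i := by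
      have : ((m + blockLength m : ℕ) : ℝ) ≤ 2 * m := by exact_mod_cast (by omega)
      linarith
    gcongr
  have h3 : (t (i + 1) : ℝ) < t i + blockLength m + blockLength (m + blockLength m) := by
    exact_mod_cast hlt
  linarith

theorem mainTheorem4 :
    ∃ t : ℕ → ℕ, StrictMono t ∧ (∀ i, 0 < t i) ∧
      AvoidsIntegerRatioGP 3 (Set.range t) ∧
      ∀ ε : ℝ, 0 < ε → ∃ C : ℝ, 0 < C ∧
        ∀ i : ℕ, (t (i + 1) : ℝ) - (t i : ℝ) < C * (t i : ℝ) ^ ε := by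
  obtain ⟨s₀, hpos, hs₀⟩ := exists_forall_ge_blockLength_le
  obtain ⟨t, ht, hind⟩ := exists_block_transversal hpos hs₀
  have ht0 (i : ℕ) : 0 < t i :=
    hpos.trans_le ((blockStart_mono s₀ (Nat.zero_le i)).trans (ht i).1)
  exact ⟨t, strictMono_nat_of_lt_succ fun i => (ht i).2.trans_le (ht (i + 1)).1, ht0,
    avoidsIntegerRatioGP_range ht0 hind, fun _ hε => exists_gap_lt_mul_rpow hpos hs₀ ht hε⟩
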